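/- Fix an algebraic first-order language $\mathcal L$ (function symbols only); algebras have nonempty universes, and all class operators are taken up to isomorphism. For a class $\mathcal K$ of $\mathcal L$-algebras, $\mathbb S(\mathcal K)$ is the class of subalgebras of members of $\mathcal K$, $\mathbb P_u(\mathcal K)$ the class of ultraproducts of families of members of $\mathcal K$, $\mathcal K\times\mathcal K=\{\mathbf A\times\mathbf B:\mathbf A,\mathbf B\in\mathcal K\}$, and $\mathbb P_k(\mathcal K)$ the class of products of $k$ members of $\mathcal K$ (repetitions allowed). If $\mathbf A\le\mathbf B$ is a subalgebra, write $\mathbf A\le_e\mathbf B$ in $\mathcal K$ if for every $\mathbf C\in\mathcal K$, any two homomorphisms $g,g':\mathbf B\to\mathbf C$ that agree on $A$ are equal. A homomorphism $h:\mathbf A\to\mathbf B$ is a $\mathcal K$-epimorphism if for every $\mathbf C\in\mathcal K$ and all homomorphisms $g,g':\mathbf B\to\mathbf C$, $gh=g'h$ implies $g=g'$; $\mathcal K$ has surjective epimorphisms if every $\mathcal K$-epimorphism between members of $\mathcal K$ is surjective. A term $t(x_1,\dots,x_n)$ with $n\ge 3$ is a near-unanimity term for $\mathcal K$ if $\mathcal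 K\models t(x,\dots,x,y)=t(x,\dots,x,y,x)=\dots=t(y,x,\dots,x)=x$; it is a majority term if $n=3$. A quasivariety is a class of algebras axiomatized by quasi-identities. For a quasivariety $\mathcal Q$, $\mathcal Q_{RSI}$ is the class of all $\mathbf A\in\mathcal Q$ whose diagonal congruence is completely meet irreducible in the lattice of $\mathcal Q$-congruences of $\mathbf A$, i.e. of the congruences $\theta$ with $\mathbf A/\theta\in\mathcal Q$ (so one-element algebras are excluded). **Theorem.** Let $\mathcal Q$ be a quasivariety and let $\mathcal S=\mathbb P_u(\mathcal Q_{RSI})$. (a) If $\mathcal Q$ has a majority term, then the following are equivalent: 1. $\mathcal Q$ has surjective epimorphisms. 2. For all $\mathbf A,\mathbf B\in\mathcal Q$, if $\mathbf A\le_e\mathbf B$ in $\mathcal Q$ then $\mathbf A=\mathbf B$. 3. For all $\mathbf A,\mathbf B\in\mathbb S(\mathcal S\times\mathcal S)$, if $\mathbf A\le_e\mathbf B$ in $\mathcal S\times\mathcal S$ then $\mathbf A=\mathbf B$. 4. $\mathbb S(\mathcal S\times\mathcal S)$ has surjective epimorphisms. (b) More generally, if $\mathcal Q$ has an $n$-ary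 near-unanimity term ($n\ge 3$), then for every $k\ge n-1$ the following are equivalent: 1. $\mathcal Q$ has surjective epimorphisms. 2. For all $\mathbf A,\mathbf B\in\mathcal Q$, if $\mathbf A\le_e\mathbf B$ in $\mathcal Q$ then $\mathbf A=\mathbf B$. 3. For all $\mathbf A,\mathbf B\in\mathbb S\mathbb P_k(\mathcal S)$, if $\mathbf A\le_e\mathbf B$ in $\mathbb P_k(\mathcal S)$ then $\mathbf A=\mathbf B$. 4. $\mathbb S\mathbb P_k(\mathcal S)$ has surjective epimorphisms. -/

import Mathlib

open FirstOrder FirstOrder.Language CategoryTheory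

universe u v w

namespace EpicAlg

/-- A class of `L`-structures. Algebras are structures of a language without relation symbols;
that their universes are nonempty is made explicit in the definitions below. -/
abbrev StrClass (L : FirstOrder.Language.{u, v}) : Type _ := Set (Bundled.{w} L.Structure)

section Structures

variable {L : FirstOrder.Language.{u, v}}

/-- The direct product of a family of structures, with pointwise operations. -/
instance piStructure {ι : Type*} {M : ι → Type*} [∀ i, L.Structure (M i)] :
    L.Structure (∀ i, M i) where
  funMap f x := fun i => Structure.funMap f (fun j => x j i)
  RelMap r x := ∀ i, Structure.RelMap r (fun j => x j i)

/-- The direct product of two structures, with componentwise operations. -/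
instance prodStructure {M N : Type*} [L.Structure M] [L.Structure N] : L.Structure (M × N) where
  funMap f x := (Structure.funMap f (fun j => (x j).1), Structure.funMap f (fun j => (x j).2))
  RelMap r x := Structure.RelMap r (fun j => (x j).1) ∧ Structure.RelMap r (fun j => (x j).2)

/-- A congruence: an equivalence relation compatible with all basic operations. -/
def IsCongruence (L : FirstOrder.Language.{u, v}) {M : Type w} [L.Structure M]
    (s : Setoid M) : Prop :=
  ∀ ⦃n : ℕ⦄ (f : L.Functions n) (x y : Fin n → M), (∀ i, s (x i) (y i)) →
    s (Structure.funMap f x) (Structure.funMap f y)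

/-- The data from which Mathlib forms the quotient of an algebra by a congruence. -/
@[reducible] def IsCongruence.prestructure [L.IsAlgebraic] {M : Type w} [str : L.Structure M]
    {s : Setoid M} (h : IsCongruence L s) : L.Prestructure s where
  toStructure := str
  fun_equiv {_} f x y hxy := h f x y hxy
  rel_equiv {_ r} := isEmptyElim r

/-- The quotient algebra `M / s`. -/
def IsCongruence.quotient [L.IsAlgebraic] {M : Type w} [L.Structure M]
    {s : Setoid M} (h : IsCongruence L s) : Bundled.{w} L.Structure :=
  ⟨Quotient s, @FirstOrder.Language.quotientStructure L M s h.prestructure⟩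

end Structures

section Classes

variable {L : FirstOrder.Language.{u, v}}

/-- Ultraproducts (up to isomorphism) of families of members of `K`. -/
def ultraproducts (K : StrClass.{u, v, w} L) : StrClass.{u, v, w} L :=
  {A | ∃ (ι : Type w) (U : Ultrafilter ι) (M : ι → Bundled.{w} L.Structure),
    (∀ i, M i ∈ K) ∧ Nonempty (A ≃[L] (U : Filter ι).Product (fun i => M i))}

/-- Nonempty substructures (up to isomorphism) of members of `K`. -/
def substructures (K : StrClass.{u, v, w} L) : StrClass.{u, v, w} L :=
  {A | Nonempty A ∧ ∃ B ∈ K, Nonempty (A ↪[L] B)}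

/-- `K × K`: the products (up to isomorphism) of two members of `K`. -/
def binaryProducts (K : StrClass.{u, v, w} L) : StrClass.{u, v, w} L :=
  {A | ∃ B ∈ K, ∃ C ∈ K, Nonempty (A ≃[L] (B × C))}

/-- The products (up to isomorphism) of exactly `k` members of `K`, repetitions allowed. -/
def finiteProducts (k : ℕ) (K : StrClass.{u, v, w} L) : StrClass.{u, v, w} L :=
  {A | ∃ M : Fin k → Bundled.{w} L.Structure,
    (∀ i, M i ∈ K) ∧ Nonempty (A ≃[L] (∀ i, M i))}

/-- A homomorphism `h : A → B` is a `K`-epimorphism if it is right-cancellable with respect to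
homomorphisms from `B` into members of `K`. -/
def IsEpimorphism (K : StrClass.{u, v, w} L) {A B : Type w} [L.Structure A] [L.Structure B]
    (h : A →[L] B) : Prop :=
  ∀ C ∈ K, ∀ g g' : B →[L] C, g.comp h = g'.comp h → g = g'

/-- Every `K`-epimorphism between members of `K` is surjective. -/
def HasSurjectiveEpimorphisms (K : StrClass.{u, v, w} L) : Prop :=
  ∀ A ∈ K, ∀ B ∈ K, ∀ h : A →[L] B, IsEpimorphism K h → Function.Surjective h

/-- `A` is an epic substructure of `B` in `K`. -/
def IsEpicSubstructure (K : StrClass.{u, v, w} L) {B : Type w} [L.Structure B]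
    (A : L.Substructure B) : Prop :=
  ∀ C ∈ K, ∀ g g' : B →[L] C, (∀ a ∈ A, g a = g' a) → g = g'

/-- For all `A ≤ B` both in `M`: if `A` is an epic substructure of `B` in `K`, then `A = B`. -/
def NoProperEpic (M K : StrClass.{u, v, w} L) : Prop :=
  ∀ B ∈ M, ∀ A : L.Substructure B, (Bundled.of A : Bundled.{w} L.Structure) ∈ M →
    IsEpicSubstructure K A → A = ⊤

end Classes

section Quasivarieties

/-- A quasi-identity `s₁ = t₁ ∧ ⋯ ∧ sₘ = tₘ → s = t` (with `m = 0` allowed). -/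
structure QuasiIdentity (L : FirstOrder.Language.{u, v}) where
  premises : List (L.Term ℕ × L.Term ℕ)
  conclusion : L.Term ℕ × L.Term ℕ

variable {L : FirstOrder.Language.{u, v}}

/-- The universally quantified quasi-identity holds in `A`. -/
def QuasiIdentity.Holds (q : QuasiIdentity L) (A : Type w) [L.Structure A] : Prop :=
  ∀ x : ℕ → A, (∀ p ∈ q.premises, p.1.realize x = p.2.realize x) →
    q.conclusion.1.realize x = q.conclusion.2.realize x

/-- A quasivariety: the class of all (nonempty) models of some set of quasi-identities. -/
def IsQuasivariety (Q : StrClass.{u, v, w} L) : Prop :=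
  ∃ E : Set (QuasiIdentity L), ∀ A : Bundled.{w} L.Structure,
    A ∈ Q ↔ Nonempty A ∧ ∀ q ∈ E, q.Holds A

/-- The `Q`-congruences of `A`: the congruences `s` with `A / s` in `Q`. -/
def relCongruences [L.IsAlgebraic] (Q : StrClass.{u, v, w} L) (A : Type w) [L.Structure A] :
    Set (Setoid A) :=
  {s | ∃ h : IsCongruence L s, h.quotient ∈ Q}

/-- The relatively subdirectly irreducible members of `Q`: the equality relation `⊥` of `A` is
completely meet irreducible among the `Q`-congruences of `A`. For a quasivariety `Q` the meets of
`Q`-congruences are intersections, that is, infima in `Setoid A`. The empty meet is the total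
relation, so one-element algebras are not included. -/
def relSubdirectlyIrreducible [L.IsAlgebraic] (Q : StrClass.{u, v, w} L) :
    StrClass.{u, v, w} L :=
  {A | A ∈ Q ∧ ∀ X ⊆ relCongruences Q A, sInf X = ⊥ → ⊥ ∈ X}

/-- `t(x₁, …, xₙ)` is a near-unanimity term for `K`: `n ≥ 3`, and in every member of `K` the value
of `t` is `x` whenever all its arguments but at most one equal `x`. -/
def IsNearUnanimityTerm (K : StrClass.{u, v, w} L) {n : ℕ} (t : L.Term (Fin n)) : Prop :=
  3 ≤ n ∧ ∀ A ∈ K, ∀ (i : Fin n) (x y : A),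
    t.realize (Function.update (fun _ => x) i y) = x

/-- A majority term is a ternary near-unanimity term. -/
def IsMajorityTerm (K : StrClass.{u, v, w} L) (t : L.Term (Fin 3)) : Prop :=
  IsNearUnanimityTerm K t

end Quasivarieties

end EpicAlg

/-! Passing to images makes surjectivity of epimorphisms the same as absence of proper epic
subalgebras, so the content is 2 ⇔ 3. Homomorphisms into relatively subdirectly irreducibles
separate points of members of `Q`, hence so do those into `P_k(S)`. Epic in `P_k(S)` therefore means
epic in `Q`, and 3 follows from 2. For the converse, let `A` be epic in `B`, let `b` be in `B`, and
separate points of `B` by maps `f i` into `Q_RSI`. A `k`-tuple of ultrafilters on the index set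
sends `B` onto an algebra in `SP_k(S)`. The image of `A` is epic there, hence everything by 3, so
some `a` in `A` agrees with `b` on a large set for each of the `k` ultrafilters. Compactness of the
space of `k`-tuples reduces this to finitely many `a`. A Baker–Pixley argument with the
near-unanimity term (`exists_agree_of_ultrafilters`) then yields one `a` agreeing with `b` at every
index, so `b = a` lies in `A`. -/

namespace EpicAlg

/-! ### Homomorphisms into products, ultraproducts and quotients -/

section Homs

variable {L : FirstOrder.Language.{u, v}} [L.IsAlgebraic]

/-- In an algebraic language, a map compatible with all operations is a homomorphism. -/
def algHom {M N : Type*} [L.Structure M] [L.Structure N] (f : M → N)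
    (h : ∀ (n : ℕ) (F : L.Functions n) (x : Fin n → M),
      f (Structure.funMap F x) = Structure.funMap F (f ∘ x)) : M →[L] N where
  toFun := f
  map_fun' F x := h _ F x
  map_rel' r := isEmptyElim r

/-- The homomorphism into a product given by its components. -/
def piHom {M : Type*} [L.Structure M] {ι : Type*} {N : ι → Type*} [∀ i, L.Structure (N i)]
    (f : ∀ i, M →[L] N i) : M →[L] (∀ i, N i) :=
  algHom (fun x i => f i x) fun _ F x => funext fun i => (f i).map_fun F x

/-- The projection of a product to a factor. -/
def projHom {ι : Type*} (N : ι → Type*) [∀ i, L.Structure (N i)] (i : ι) :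
    (∀ i, N i) →[L] N i :=
  algHom (fun x => x i) fun _ _ _ => rfl

/-- The homomorphism into an ultraproduct given by homomorphisms into the factors. -/
def ultraproductHom {M : Type*} [L.Structure M] {ι : Type*} (U : Ultrafilter ι) {N : ι → Type*}
    [∀ i, L.Structure (N i)] (f : ∀ i, M →[L] N i) : M →[L] (U : Filter ι).Product N :=
  algHom (fun x => ((fun i => f i x : ∀ i, N i) : (U : Filter ι).Product N)) fun _ F x => by
    refine Eq.trans ?_ (Ultraproduct.funMap_cast (u := U) F fun j i => f i (x j)).symm
    congr 1
    exact funext fun i => (f i).map_fun F x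

theorem ultraproductHom_eq_iff {M : Type*} [L.Structure M] {ι : Type*} (U : Ultrafilter ι)
    {N : ι → Type*} [∀ i, L.Structure (N i)] (f : ∀ i, M →[L] N i) (x y : M) :
    ultraproductHom U f x = ultraproductHom U f y ↔ {i | f i x = f i y} ∈ U :=
  Quotient.eq''

/-- The canonical homomorphism onto a quotient algebra. -/
def IsCongruence.mkHom {M : Type w} [L.Structure M] {s : Setoid M} (h : IsCongruence L s) :
    M →[L] h.quotient :=
  algHom (fun x => (Quotient.mk s x : Quotient s)) fun _ F x =>
    (@funMap_quotient_mk' L M s h.prestructure _ F x).symm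

theorem IsCongruence.mkHom_surjective {M : Type w} [L.Structure M] {s : Setoid M}
    (h : IsCongruence L s) : Function.Surjective h.mkHom :=
  Quotient.mk_surjective

theorem IsCongruence.mkHom_eq_iff {M : Type w} [L.Structure M] {s : Setoid M}
    (h : IsCongruence L s) (x y : M) : h.mkHom x = h.mkHom y ↔ s x y :=
  Quotient.eq

end Homs

/-! ### Closure properties of quasivarieties -/

section QuasiIdentities

variable {L : FirstOrder.Language.{u, v}} {Q : StrClass.{u, v, w} L}

/-- A quasi-identity passes to algebras that are separated by homomorphisms into its models. -/
theorem QuasiIdentity.Holds.of_jointly_injective {q : QuasiIdentity L} {A : Type*}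
    [L.Structure A] {ι : Type*} {M : ι → Type*} [∀ i, L.Structure (M i)]
    (f : ∀ i, A →[L] M i) (hf : ∀ x y, (∀ i, f i x = f i y) → x = y)
    (hq : ∀ i, q.Holds (M i)) : q.Holds A := by
  intro x hx
  refine hf _ _ fun i => ?_
  rw [← HomClass.realize_term, ← HomClass.realize_term]
  refine hq i _ fun p hp => ?_
  rw [HomClass.realize_term, HomClass.realize_term, hx p hp]

theorem QuasiIdentity.Holds.ultraproduct {q : QuasiIdentity L} {ι : Type*} (U : Ultrafilter ι)
    {M : ι → Type*} [∀ i, L.Structure (M i)] (hq : ∀ i, q.Holds (M i)) :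
    q.Holds ((U : Filter ι).Product M) := by
  intro x hx
  choose y hy using fun n => Quotient.exists_rep (x n)
  obtain rfl : (fun n => (y n : (U : Filter ι).Product M)) = x := funext hy
  have key : ∀ t t' : L.Term ℕ,
      t.realize (fun n => (y n : (U : Filter ι).Product M)) =
        t'.realize (fun n => (y n : (U : Filter ι).Product M)) ↔
      ∀ᶠ i in (U : Filter ι), t.realize (fun n => y n i) = t'.realize (fun n => y n i) := by
    intro t t'
    rw [Ultraproduct.term_realize_cast, Ultraproduct.term_realize_cast]
    exact Quotient.eq''
  have hx' : ∀ p ∈ {p | p ∈ q.premises}, ∀ᶠ i in (U : Filter ι),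
      p.1.realize (fun n => y n i) = p.2.realize (fun n => y n i) :=
    fun p hp => (key _ _).1 (hx p hp)
  -- There are finitely many premises, so they hold simultaneously on a large set.
  rw [← Filter.eventually_all_finite (List.finite_toSet q.premises)] at hx'
  exact (key _ _).2 (hx'.mono fun i hi => hq i _ hi)

theorem IsQuasivariety.nonempty (hQ : IsQuasivariety Q) {A : Bundled.{w} L.Structure}
    (hA : A ∈ Q) : Nonempty A := by
  obtain ⟨E, hE⟩ := hQ
  exact ((hE A).1 hA).1

theorem IsQuasivariety.mem_of_jointly_injective (hQ : IsQuasivariety Q)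
    {A : Bundled.{w} L.Structure} [hA : Nonempty A] {ι : Type*} {M : ι → Bundled.{w} L.Structure}
    (hM : ∀ i, M i ∈ Q) (f : ∀ i, A →[L] M i) (hf : ∀ x y, (∀ i, f i x = f i y) → x = y) :
    A ∈ Q := by
  obtain ⟨E, hE⟩ := hQ
  exact (hE A).2 ⟨hA, fun q hq =>
    QuasiIdentity.Holds.of_jointly_injective f hf fun i => ((hE _).1 (hM i)).2 q hq⟩

theorem IsQuasivariety.mem_of_injective (hQ : IsQuasivariety Q)
    {A B : Bundled.{w} L.Structure} [Nonempty A] (hB : B ∈ Q) (f : A →[L] B)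
    (hf : Function.Injective f) : A ∈ Q :=
  hQ.mem_of_jointly_injective (ι := Unit) (fun _ => hB) (fun _ => f) fun _ _ h => hf (h ())

theorem IsQuasivariety.ultraproducts_subset (hQ : IsQuasivariety Q) {K : StrClass.{u, v, w} L}
    (hK : K ⊆ Q) : ultraproducts K ⊆ Q := by
  rintro A ⟨ι, U, M, hM, ⟨e⟩⟩
  have hn : ∀ i, Nonempty (M i) := fun i => hQ.nonempty (hK (hM i))
  have hne : Nonempty ((U : Filter ι).Product fun i => M i) := ⟨Quotient.mk _ fun i => (hn i).some⟩
  have : Nonempty A := hne.map e.symm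
  refine hQ.mem_of_injective (B := ⟨(U : Filter ι).Product fun i => M i, inferInstance⟩) ?_
    e.toHom e.injective
  obtain ⟨E, hE⟩ := hQ
  exact (hE _).2 ⟨hne, fun q hq =>
    QuasiIdentity.Holds.ultraproduct U fun i => ((hE _).1 (hK (hM i))).2 q hq⟩

theorem IsQuasivariety.substructures_subset (hQ : IsQuasivariety Q) {K : StrClass.{u, v, w} L}
    (hK : K ⊆ Q) : substructures K ⊆ Q := by
  rintro A ⟨hA, B, hB, ⟨f⟩⟩
  exact hQ.mem_of_injective (hK hB) f.toHom f.injective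

variable [L.IsAlgebraic]

theorem IsQuasivariety.finiteProducts_subset (hQ : IsQuasivariety Q) {K : StrClass.{u, v, w} L}
    (hK : K ⊆ Q) (k : ℕ) : finiteProducts k K ⊆ Q := by
  rintro A ⟨M, hM, ⟨e⟩⟩
  have hn : ∀ i, Nonempty (M i) := fun i => hQ.nonempty (hK (hM i))
  have : Nonempty A := ⟨e.symm fun i => (hn i).some⟩
  exact hQ.mem_of_jointly_injective (fun i => hK (hM i))
    (fun i => (projHom (fun i => M i) i).comp e.toHom) fun x y h => e.injective (funext h)

theorem relSubdirectlyIrreducible_subset : relSubdirectlyIrreducible Q ⊆ Q := fun _ h => h.1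

end QuasiIdentities

/-! ### Relative congruences and relatively subdirectly irreducible quotients -/

section SubdirectDecomposition

variable {L : FirstOrder.Language.{u, v}} [L.IsAlgebraic] {Q : StrClass.{u, v, w} L}
  {E : Set (QuasiIdentity L)}

/-- Rephrases membership of the quotient in `Q` as finitary closure conditions on the relation
itself; such conditions survive preimages and unions of chains. -/
theorem mem_relCongruences_iff
    (hE : ∀ A : Bundled.{w} L.Structure, A ∈ Q ↔ Nonempty A ∧ ∀ q ∈ E, q.Holds A)
    {A : Type w} [L.Structure A] [Nonempty A] {s : Setoid A} :
    s ∈ relCongruences Q A ↔ IsCongruence L s ∧ ∀ q ∈ E, ∀ x : ℕ → A,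
      (∀ p ∈ q.premises, s (p.1.realize x) (p.2.realize x)) →
        s (q.conclusion.1.realize x) (q.conclusion.2.realize x) := by
  have key : ∀ (h : IsCongruence L s) (t t' : L.Term ℕ) (x : ℕ → A),
      t.realize (h.mkHom ∘ x) = t'.realize (h.mkHom ∘ x) ↔ s (t.realize x) (t'.realize x) := by
    intro h t t' x
    rw [HomClass.realize_term, HomClass.realize_term, h.mkHom_eq_iff]
  constructor
  · rintro ⟨h, hq⟩
    refine ⟨h, fun q hqE x hx => (key h _ _ x).1 ?_⟩
    exact ((hE _).1 hq).2 q hqE _ fun p hp => (key h _ _ x).2 (hx p hp)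
  · rintro ⟨h, hq⟩
    refine ⟨h, (hE _).2 ⟨Nonempty.map h.mkHom ‹_›, fun q hqE y hy => ?_⟩⟩
    choose x hx using fun n => h.mkHom_surjective (y n)
    obtain rfl : h.mkHom ∘ x = y := funext hx
    exact (key h _ _ x).2 (hq q hqE x fun p hp => (key h _ _ x).1 (hy p hp))

/-- The preimage of a relative congruence under a homomorphism is a relative congruence. -/
theorem comap_mem_relCongruences (hQ : IsQuasivariety Q) {A B : Type w} [L.Structure A]
    [L.Structure B] [Nonempty A] (f : A →[L] B) {s : Setoid B} (hs : s ∈ relCongruences Q B) :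
    s.comap f ∈ relCongruences Q A := by
  obtain ⟨E, hE⟩ := hQ
  have : Nonempty B := Nonempty.map f ‹_›
  rw [mem_relCongruences_iff hE] at hs ⊢
  refine ⟨fun n F x y hxy => ?_, fun q hq x hx => ?_⟩
  · rw [Setoid.comap_rel, f.map_fun, f.map_fun]
    exact hs.1 F _ _ hxy
  · rw [Setoid.comap_rel, ← HomClass.realize_term, ← HomClass.realize_term]
    refine hs.2 q hq _ fun p hp => ?_
    rw [HomClass.realize_term, HomClass.realize_term]
    exact hx p hp

theorem bot_mem_relCongruences (hQ : IsQuasivariety Q) {A : Bundled.{w} L.Structure}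
    (hA : A ∈ Q) : (⊥ : Setoid A) ∈ relCongruences Q A := by
  obtain ⟨E, hE⟩ := hQ
  have hA' := (hE A).1 hA
  have := hA'.1
  rw [mem_relCongruences_iff hE]
  refine ⟨fun n F x y hxy => ?_, fun q hq x hx => hA'.2 q hq x hx⟩
  rw [show x = y from funext hxy]

/-- The union of a nonempty chain of relative congruences is a relative congruence. -/
theorem exists_chain_union_mem_relCongruences (hQ : IsQuasivariety Q) {A : Type w} [L.Structure A]
    [Nonempty A] {c : Set (Setoid A)} (hc : c ⊆ relCongruences Q A) (hchain : IsChain (· ≤ ·) c)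
    (hne : c.Nonempty) :
    ∃ s ∈ relCongruences Q A, ∀ x y, s x y ↔ ∃ r ∈ c, r x y := by
  obtain ⟨E, hE⟩ := hQ
  have hdir : DirectedOn (· ≤ ·) c := hchain.directedOn
  -- Each closure condition involves finitely many pairs, and these already lie in one member of the
  -- chain.
  have collect : ∀ {ι : Type} (T : Set ι) (_ : T.Finite) (x y : ι → A),
      (∀ i ∈ T, ∃ r ∈ c, r (x i) (y i)) → ∃ r ∈ c, ∀ i ∈ T, r (x i) (y i) := by
    intro ι T hT x y
    induction T, hT using Set.Finite.induction_on with
    | empty => exact fun _ => ⟨hne.some, hne.some_mem, by simp⟩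
    | @insert a T _ _ ih =>
      intro h
      obtain ⟨r, hr, hrT⟩ := ih fun i hi => h i (Set.mem_insert_of_mem _ hi)
      obtain ⟨r', hr', hra⟩ := h a (Set.mem_insert _ _)
      obtain ⟨r'', hr'', h1, h2⟩ := hdir r hr r' hr'
      refine ⟨r'', hr'', fun i hi => ?_⟩
      rcases hi with rfl | hi
      · exact h2 hra
      · exact h1 (hrT i hi)
  refine ⟨⟨fun x y => ∃ r ∈ c, r x y, ?_, ?_, ?_⟩, ?_, fun _ _ => Iff.rfl⟩
  · exact fun x => ⟨hne.some, hne.some_mem, hne.some.refl' x⟩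
  · exact fun ⟨r, hr, h⟩ => ⟨r, hr, r.symm' h⟩
  · rintro x y z ⟨r, hr, h⟩ ⟨r', hr', h'⟩
    obtain ⟨r'', hr'', h1, h2⟩ := hdir r hr r' hr'
    exact ⟨r'', hr'', r''.trans' (h1 h) (h2 h')⟩
  · rw [mem_relCongruences_iff hE]
    refine ⟨fun n F x y hxy => ?_, fun q hq x hx => ?_⟩
    · obtain ⟨r, hr, h⟩ := collect Set.univ Set.finite_univ x y fun i _ => hxy i
      exact ⟨r, hr, (hc hr).1 F x y fun i => h i trivial⟩
    · have hx' : ∀ i ∈ (Set.univ : Set (Fin q.premises.length)),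
          ∃ r ∈ c, r ((q.premises.get i).1.realize x) ((q.premises.get i).2.realize x) :=
        fun i _ => hx _ (List.get_mem _ i)
      obtain ⟨r, hr, h⟩ := collect Set.univ Set.finite_univ _ _ hx'
      refine ⟨r, hr, ((mem_relCongruences_iff hE).1 (hc hr)).2 q hq x fun p hp => ?_⟩
      obtain ⟨i, rfl⟩ := List.get_of_mem hp
      exact h i trivial

/-- The homomorphisms from a member of a quasivariety into the relatively subdirectly irreducible
members separate points. -/
theorem IsQuasivariety.exists_hom_relSubdirectlyIrreducible (hQ : IsQuasivariety Q)
    {A : Bundled.{w} L.Structure} (hA : A ∈ Q) {a b : A} (hab : a ≠ b) :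
    ∃ C ∈ relSubdirectlyIrreducible Q, ∃ f : A →[L] C, f a ≠ f b := by
  have := hQ.nonempty hA
  -- `s` is a maximal relative congruence separating `a` from `b`; the target is `A / s`.
  obtain ⟨s, -, hs, hmax⟩ := zorn_le_nonempty₀ {s : Setoid A | s ∈ relCongruences Q A ∧ ¬ s a b}
    (fun c hc hchain y hy => by
      obtain ⟨s, hs, hiff⟩ := exists_chain_union_mem_relCongruences hQ (fun r hr => (hc hr).1)
        hchain ⟨y, hy⟩
      refine ⟨s, ⟨hs, fun h => ?_⟩, fun r hr x y hxy => (hiff x y).2 ⟨r, hr, hxy⟩⟩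
      obtain ⟨r, hr, h⟩ := (hiff a b).1 h
      exact (hc hr).2 h)
    ⊥ ⟨bot_mem_relCongruences hQ hA, hab⟩
  obtain ⟨⟨h, hq⟩, hsab⟩ := hs
  have hne : h.mkHom a ≠ h.mkHom b := fun he => hsab ((h.mkHom_eq_iff a b).1 he)
  refine ⟨h.quotient, ⟨hq, fun X hX hbot => ?_⟩, h.mkHom, hne⟩
  by_contra hX'
  -- By maximality of `s`, each relative congruence of `A / s` other than `⊥` identifies the images
  -- of `a` and `b`, hence so does any meet of such congruences, including the empty one.
  suffices hmem : (sInf X) (h.mkHom a) (h.mkHom b) by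
    rw [hbot] at hmem
    exact hne hmem
  intro r hr
  by_contra hrab
  have hle : s ≤ r.comap h.mkHom := fun x y hxy => by
    rw [Setoid.comap_rel, (h.mkHom_eq_iff x y).2 hxy]
  have hge := hmax (y := r.comap h.mkHom) ⟨comap_mem_relCongruences hQ h.mkHom (hX hr), hrab⟩ hle
  refine hX' ((?_ : r = ⊥) ▸ hr)
  rw [eq_bot_iff]
  intro x y hxy
  obtain ⟨x, rfl⟩ := h.mkHom_surjective x
  obtain ⟨y, rfl⟩ := h.mkHom_surjective y
  exact (h.mkHom_eq_iff x y).2 (hge hxy)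

end SubdirectDecomposition

/-! ### Epimorphisms versus epic subalgebras -/

section EpicSubstructures

variable {L : FirstOrder.Language.{u, v}} {K : StrClass.{u, v, w} L}

/-- Embedding the target into a larger algebra does not change whether two homomorphisms are equal.
-/
theorem isEpimorphism_substructures_iff {A B : Type w} [L.Structure A] [L.Structure B]
    [Nonempty B] (h : A →[L] B) :
    IsEpimorphism (substructures K) h ↔ IsEpimorphism K h := by
  constructor
  · intro hh C hC g g' hg
    exact hh C ⟨Nonempty.map g ‹_›, C, hC, ⟨Language.Embedding.refl L C⟩⟩ g g' hg
  · rintro hh C ⟨-, D, hD, ⟨e⟩⟩ g g' hg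
    have := hh D hD (e.toHom.comp g) (e.toHom.comp g')
      (by rw [Hom.comp_assoc, hg, Hom.comp_assoc])
    ext x
    exact e.injective (DFunLike.congr_fun this x)

theorem isEpimorphism_subtype_iff {B : Type w} [L.Structure B] (A : L.Substructure B) :
    IsEpimorphism K A.subtype.toHom ↔ IsEpicSubstructure K A := by
  refine forall₂_congr fun C _ => forall₂_congr fun g g' => imp_congr_left ?_
  exact ⟨fun h a ha => DFunLike.congr_fun h (⟨a, ha⟩ : A), fun h => Hom.ext fun a => h a a.2⟩

theorem isEpicSubstructure_range_iff {A B : Type w} [L.Structure A] [L.Structure B]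
    (h : A →[L] B) : IsEpicSubstructure K h.range ↔ IsEpimorphism K h := by
  refine forall₂_congr fun C _ => forall₂_congr fun g g' => imp_congr_left ?_
  constructor
  · exact fun hg => Hom.ext fun a => hg _ (h.mem_range_self a)
  · rintro hg _ ha
    obtain ⟨a, rfl⟩ := Hom.mem_range.1 ha
    exact DFunLike.congr_fun hg a

/-- The image of an epic substructure under a surjective homomorphism is epic. -/
theorem IsEpicSubstructure.map {B C : Type w} [L.Structure B] [L.Structure C]
    {A : L.Substructure B} (hA : IsEpicSubstructure K A) (f : B →[L] C)
    (hf : Function.Surjective f) : IsEpicSubstructure K (A.map f) := by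
  intro D hD g g' hg
  have := hA D hD (g.comp f) (g'.comp f) fun a ha => hg _ (Substructure.mem_map_of_mem f ha)
  ext x
  obtain ⟨y, rfl⟩ := hf x
  exact DFunLike.congr_fun this y

/-- For a class of nonempty algebras closed under nonempty substructures, surjectivity of
epimorphisms means that there are no proper epic substructures. -/
theorem hasSurjectiveEpimorphisms_iff_noProperEpic
    (hK : ∀ A ∈ K, Nonempty A)
    (hsub : ∀ B ∈ K, ∀ A : L.Substructure B, Nonempty A →
      (Bundled.of A : Bundled.{w} L.Structure) ∈ K) :
    HasSurjectiveEpimorphisms K ↔ NoProperEpic K K := by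
  constructor
  · intro h B hB A hA hepic
    have hsurj := h _ hA B hB A.subtype.toHom ((isEpimorphism_subtype_iff A).2 hepic)
    refine eq_top_iff.2 fun b _ => ?_
    obtain ⟨a, rfl⟩ := hsurj b
    exact a.2
  · intro h A hA B hB f hf b
    obtain ⟨a⟩ := hK A hA
    have := h B hB f.range (hsub B hB _ ⟨⟨f a, f.mem_range_self a⟩⟩)
      ((isEpicSubstructure_range_iff f).2 hf)
    have hb : b ∈ f.range := this ▸ Substructure.mem_top b
    exact Hom.mem_range.1 hb


theorem hasSurjectiveEpimorphisms_substructures_iff :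
    HasSurjectiveEpimorphisms (substructures K) ↔ NoProperEpic (substructures K) K := by
  rw [hasSurjectiveEpimorphisms_iff_noProperEpic (fun A hA => hA.1)]
  · refine forall₂_congr fun B hB => forall₂_congr fun A hA => imp_congr_left ?_
    have := hB.1
    rw [← isEpimorphism_subtype_iff, ← isEpimorphism_subtype_iff,
      isEpimorphism_substructures_iff]
  · rintro B ⟨-, C, hC, ⟨e⟩⟩ A hA
    exact ⟨hA, C, hC, ⟨e.comp A.subtype⟩⟩

theorem IsQuasivariety.hasSurjectiveEpimorphisms_iff [L.IsAlgebraic] {Q : StrClass.{u, v, w} L}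
    (hQ : IsQuasivariety Q) : HasSurjectiveEpimorphisms Q ↔ NoProperEpic Q Q := by
  refine hasSurjectiveEpimorphisms_iff_noProperEpic (fun A hA => hQ.nonempty hA) ?_
  intro B hB A hA
  have : Nonempty (Bundled.of A : Bundled.{w} L.Structure) := hA
  exact hQ.mem_of_injective (A := Bundled.of A) hB A.subtype.toHom A.subtype.injective

theorem binaryProducts_eq_finiteProducts [L.IsAlgebraic] :
    binaryProducts K = finiteProducts 2 K := by
  have key : ∀ M : Fin 2 → Bundled.{w} L.Structure,
      Nonempty ((∀ i, M i) ≃[L] (M 0 × M 1)) := fun M =>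
    ⟨{ toEquiv := piFinTwoEquiv fun i => M i
       map_fun' := fun _ _ => rfl
       map_rel' := fun r => isEmptyElim r }⟩
  ext A
  constructor
  · rintro ⟨B, hB, C, hC, ⟨e⟩⟩
    obtain ⟨e'⟩ := key ![B, C]
    exact ⟨![B, C], Fin.forall_fin_two.2 ⟨hB, hC⟩, ⟨e'.symm.comp e⟩⟩
  · rintro ⟨M, hM, ⟨e⟩⟩
    obtain ⟨e'⟩ := key M
    exact ⟨M 0, hM 0, M 1, hM 1, ⟨e'.comp e⟩⟩

end EpicSubstructures

/-! ### Baker–Pixley arguments for a near-unanimity term -/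

section NearUnanimity

variable {L : FirstOrder.Language.{u, v}}

/-- The finite Baker–Pixley theorem, for coloured coordinates: if for any `k` colours some element of
`A` agrees with `b` on the coordinates of these colours, the same holds for any finite set of
colours. -/
theorem exists_agree_of_finite_coloring {B : Type*} [L.Structure B] (A : L.Substructure B)
    {I : Type*} {C : I → Type*} [∀ i, L.Structure (C i)] (f : ∀ i, B →[L] C i) (b : B)
    {n k : ℕ} (t : L.Term (Fin n)) (hn : 0 < n) (hnk : n ≤ k + 1)
    (ht : ∀ i (j : Fin n) (x y : C i), t.realize (Function.update (fun _ => x) j y) = x)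
    {X : Type*} [DecidableEq X] (c : I → X)
    (hA : ∀ F : Finset X, F.card ≤ k → ∃ a ∈ A, ∀ i, c i ∈ F → f i a = f i b)
    (F : Finset X) : ∃ a ∈ A, ∀ i, c i ∈ F → f i a = f i b := by
  induction hF : F.card using Nat.strong_induction_on generalizing F with
  | _ m ih =>
    subst hF
    rcases le_or_gt F.card k with hk | hk
    · exact hA F hk
    -- Pick `n` of the more than `k` colours. Omitting the `j`-th gives an element `a j` by
    -- induction; at any coordinate coloured from `F` at most one `a j` can differ from `b`, and `t`
    -- outvotes it.
    obtain ⟨G, hGF, hG⟩ := Finset.exists_subset_card_eq (show n ≤ F.card by omega)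
    let e : Fin n ≃ G := (Finset.equivFinOfCardEq hG).symm
    have hmem : ∀ j, (e j : X) ∈ F := fun j => hGF (e j).2
    choose a ha hab using fun j =>
      ih _ (Finset.card_erase_lt_of_mem (hmem j)) (F.erase (e j)) rfl
    refine ⟨t.realize a, t.realize_mem a ha, fun i hi => ?_⟩
    rw [← HomClass.realize_term]
    by_cases hj : ∃ j, (e j : X) = c i
    · obtain ⟨j, hj⟩ := hj
      have : f i ∘ a = Function.update (fun _ => f i b) j (f i (a j)) := by
        funext l
        rcases eq_or_ne l j with rfl | hl
        · simp
        · rw [Function.update_of_ne hl]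
          refine hab l i (Finset.mem_erase.2 ⟨fun h => hl ?_, hi⟩)
          exact e.injective (Subtype.ext (h.symm.trans hj.symm))
      rw [this, ht]
    · have : f i ∘ a = fun _ => f i b := funext fun l =>
        hab l i (Finset.mem_erase.2 ⟨fun h => hj ⟨l, h.symm⟩, hi⟩)
      rw [this, ← Function.update_eq_self (⟨0, hn⟩ : Fin n) (fun _ : Fin n => f i b), ht]

/-- A compact form of the Baker–Pixley theorem: if every `k`-tuple of ultrafilters on the set of
coordinates has a common member on which `b` agrees with an element of `A`, then some
element of `A` agrees with `b` everywhere. -/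
theorem exists_agree_of_ultrafilters {B : Type*} [L.Structure B] (A : L.Substructure B)
    {I : Type*} {C : I → Type*} [∀ i, L.Structure (C i)] (f : ∀ i, B →[L] C i) (b : B)
    {n k : ℕ} (t : L.Term (Fin n)) (hn : 0 < n) (hnk : n ≤ k + 1)
    (ht : ∀ i (j : Fin n) (x y : C i), t.realize (Function.update (fun _ => x) j y) = x)
    (hne : Nonempty A)
    (hA : ∀ U : Fin k → Ultrafilter I, ∃ a ∈ A, ∀ j, {i | f i a = f i b} ∈ U j) :
    ∃ a ∈ A, ∀ i, f i a = f i b := by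
  classical
  -- By `hA`, the open sets attached to the elements of `A` cover the compact space of `k`-tuples of
  -- ultrafilters.
  obtain ⟨T, hT⟩ := isCompact_univ.elim_finite_subcover
    (fun a : A => {U : Fin k → Ultrafilter I | ∀ j, {i | f i a = f i b} ∈ U j})
    (fun a => by
      have : {U : Fin k → Ultrafilter I | ∀ j, {i | f i a = f i b} ∈ U j} =
          Set.univ.pi fun _ => {V : Ultrafilter I | {i | f i a = f i b} ∈ V} := by
        ext U
        simp
      rw [this]
      exact isOpen_set_pi Set.finite_univ fun _ _ => ultrafilter_isOpen_basic _)
    (fun U _ => by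
      obtain ⟨a, ha, h⟩ := hA U
      exact Set.mem_iUnion.2 ⟨⟨a, ha⟩, h⟩)
  -- Apply the finite subcover to principal ultrafilters.
  have hT' : ∀ s : Fin k → I, ∃ a ∈ T, ∀ j, f (s j) a = f (s j) b := by
    intro s
    obtain ⟨a, ha, h⟩ := Set.mem_iUnion₂.1 (hT (Set.mem_univ fun j => (pure (s j) : Ultrafilter I)))
    exact ⟨a, ha, fun j => h j⟩
  rcases isEmpty_or_nonempty I with hI | hI
  · exact ⟨hne.some, hne.some.2, fun i => hI.elim i⟩
  -- The colour of `i` records which elements of `T` agree with `b` there, so one representative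
  -- coordinate decides for its whole colour.
  let c : I → Finset A := fun i => T.filter fun a => f i a = f i b
  obtain ⟨a, ha, h⟩ := exists_agree_of_finite_coloring A f b t hn hnk ht c (fun F hF => by
    rcases F.eq_empty_or_nonempty with rfl | hFne
    · exact ⟨hne.some, hne.some.2, by simp⟩
    have : Nonempty F := hFne.to_subtype
    obtain ⟨s⟩ : Nonempty (F ↪ Fin k) :=
      Function.Embedding.nonempty_of_card_le (by simpa using hF)
    -- One coordinate per colour in `F`; slots outside the range of `s`, and colours that do not
    -- occur, get arbitrary values, which is harmless.
    obtain ⟨a, ha, h⟩ := hT' fun j => Function.invFun c (Function.invFun s j).1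
    refine ⟨a, a.2, fun i hi => ?_⟩
    have hs := h (s ⟨c i, hi⟩)
    rw [Function.leftInverse_invFun s.injective] at hs
    have hmem : a ∈ c (Function.invFun c (c i)) := Finset.mem_filter.2 ⟨ha, hs⟩
    rw [Function.invFun_eq (f := c) ⟨i, rfl⟩] at hmem
    exact (Finset.mem_filter.1 hmem).2) T.powerset
  exact ⟨a, ha, fun i => h i (Finset.mem_powerset.2 (Finset.filter_subset _ _))⟩

end NearUnanimity

/-! ### Transfer between `Q` and products of ultraproducts -/

section Main

variable {L : FirstOrder.Language.{u, v}} [L.IsAlgebraic] {Q : StrClass.{u, v, w} L}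

/-- The homomorphisms from a member of a quasivariety `Q` into products of `k > 0` ultraproducts of
relatively subdirectly irreducible members separate points. -/
theorem IsQuasivariety.exists_hom_finiteProducts (hQ : IsQuasivariety Q) {k : ℕ} (hk : 0 < k)
    {A : Bundled.{w} L.Structure} (hA : A ∈ Q) {a b : A} (hab : a ≠ b) :
    ∃ C ∈ finiteProducts k (ultraproducts (relSubdirectlyIrreducible Q)),
      ∃ f : A →[L] C, f a ≠ f b := by
  obtain ⟨C, hC, f, hf⟩ := hQ.exists_hom_relSubdirectlyIrreducible hA hab
  -- A one-factor ultraproduct, then the diagonal into its `k`-th power, puts `C` inside a member of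
  -- the class.
  let U : Ultrafilter PUnit.{w + 1} := pure PUnit.unit
  let D : Bundled.{w} L.Structure :=
    ⟨(U : Filter PUnit).Product fun _ => C, inferInstance⟩
  have hD : D ∈ ultraproducts (relSubdirectlyIrreducible Q) :=
    ⟨PUnit, U, fun _ => C, fun _ => hC, ⟨Language.Equiv.refl L D⟩⟩
  let g : A →[L] D := ultraproductHom U fun _ => f
  have hg : g a ≠ g b := fun h => hf ((ultraproductHom_eq_iff U (fun _ => f) a b).1 h)
  refine ⟨⟨∀ _ : Fin k, D, inferInstance⟩, ⟨fun _ => D, fun _ => hD, ⟨Language.Equiv.refl L _⟩⟩,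
    piHom fun _ => g, fun h => hg ?_⟩
  exact congrFun h ⟨0, hk⟩

/-- A substructure that is epic with respect to the products of `k > 0` ultraproducts of relatively
subdirectly irreducible members of `Q` is epic in `Q`. -/
theorem IsQuasivariety.isEpicSubstructure_of_finiteProducts (hQ : IsQuasivariety Q) {k : ℕ}
    (hk : 0 < k) {B : Type w} [L.Structure B] {A : L.Substructure B}
    (hA : IsEpicSubstructure
      (finiteProducts k (ultraproducts (relSubdirectlyIrreducible Q))) A) :
    IsEpicSubstructure Q A := by
  intro C hC g g' hg
  ext x
  by_contra hne
  obtain ⟨D, hD, f, hf⟩ := hQ.exists_hom_finiteProducts hk hC hne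
  refine hf (DFunLike.congr_fun (hA D hD (f.comp g) (f.comp g') fun a ha => ?_) x)
  exact congrArg f (hg a ha)

theorem IsQuasivariety.finiteProducts_ultraproducts_subset (hQ : IsQuasivariety Q) (k : ℕ) :
    finiteProducts k (ultraproducts (relSubdirectlyIrreducible Q)) ⊆ Q :=
  hQ.finiteProducts_subset (hQ.ultraproducts_subset relSubdirectlyIrreducible_subset) k

theorem IsQuasivariety.noProperEpic_of_finiteProducts (hQ : IsQuasivariety Q) {n k : ℕ}
    {t : L.Term (Fin n)} (ht : IsNearUnanimityTerm Q t) (hnk : n ≤ k + 1)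
    (h : NoProperEpic
      (substructures (finiteProducts k (ultraproducts (relSubdirectlyIrreducible Q))))
      (finiteProducts k (ultraproducts (relSubdirectlyIrreducible Q)))) :
    NoProperEpic Q Q := by
  intro B hB A hA hepic
  have hne : Nonempty A := hQ.nonempty hA
  -- The coordinates are the pairs of distinct elements of `B`, each with a map separating it.
  choose C hC f hf using fun p : {p : B × B // p.1 ≠ p.2} =>
    hQ.exists_hom_relSubdirectlyIrreducible hB p.2
  refine eq_top_iff.2 fun b _ => ?_
  obtain ⟨a, ha, hab⟩ := exists_agree_of_ultrafilters A f b t (by have := ht.1; omega) hnk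
    (fun p => ht.2 (C p) (hC p).1) hne fun U => by
      let D : Fin k → Bundled.{w} L.Structure := fun j =>
        ⟨(U j : Filter {p : B × B // p.1 ≠ p.2}).Product fun p => C p, inferInstance⟩
      let P : Bundled.{w} L.Structure := ⟨∀ j, D j, inferInstance⟩
      have hP : P ∈ finiteProducts k (ultraproducts (relSubdirectlyIrreducible Q)) :=
        ⟨D, fun j => ⟨_, U j, C, hC, ⟨Language.Equiv.refl L (D j)⟩⟩, ⟨Language.Equiv.refl L P⟩⟩
      let g : B →[L] P := piHom fun j => ultraproductHom (U j) f
      -- Epicness passes to images only along surjections, hence the corestriction to the range.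
      let g' : B →[L] g.range := g.codRestrict g.range g.mem_range_self
      have hg' : Function.Surjective g' := by
        rintro ⟨x, hx⟩
        obtain ⟨y, rfl⟩ := Hom.mem_range.1 hx
        exact ⟨y, rfl⟩
      have htop : A.map g' = ⊤ := by
        refine h (Bundled.of g.range) ⟨hne.map fun a => g' a.1, P, hP, ⟨g.range.subtype⟩⟩ (A.map g')
          ⟨hne.map fun a => ⟨g' a.1, Substructure.mem_map_of_mem g' a.2⟩, P, hP,
            ⟨g.range.subtype.comp (A.map g').subtype⟩⟩ ?_
        exact fun E hE =>
          hepic.map g' hg' E (hQ.finiteProducts_ultraproducts_subset k hE)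
      obtain ⟨a, ha, hab⟩ := Substructure.mem_map.1
        (htop ▸ Substructure.mem_top (g' b) : g' b ∈ A.map g')
      refine ⟨a, ha, fun j => (ultraproductHom_eq_iff (U j) f a b).1 ?_⟩
      exact congrFun (congrArg Subtype.val hab) j
  obtain rfl : a = b := by
    by_contra hne
    exact hf ⟨(a, b), hne⟩ (hab ⟨(a, b), hne⟩)
  exact ha

theorem IsQuasivariety.noProperEpic_iff_finiteProducts (hQ : IsQuasivariety Q) {n k : ℕ}
    {t : L.Term (Fin n)} (ht : IsNearUnanimityTerm Q t) (hnk : n ≤ k + 1) :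
    NoProperEpic Q Q ↔ NoProperEpic
      (substructures (finiteProducts k (ultraproducts (relSubdirectlyIrreducible Q))))
      (finiteProducts k (ultraproducts (relSubdirectlyIrreducible Q))) := by
  refine ⟨fun h B hB A hA hepic => ?_, hQ.noProperEpic_of_finiteProducts ht hnk⟩
  have hsub := hQ.substructures_subset (hQ.finiteProducts_ultraproducts_subset k)
  have := ht.1
  exact h B (hsub hB) A (hsub hA)
    -- `0 < k` comes from `3 ≤ n ≤ k + 1`.
    (hQ.isEpicSubstructure_of_finiteProducts (by omega) hepic)

end Main

end EpicAlg

theorem theorem4p2 (L : FirstOrder.Language.{u, v}) [L.IsAlgebraic]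
    (Q S : EpicAlg.StrClass.{u, v, max u v w} L)
    (hQ : EpicAlg.IsQuasivariety Q)
    (hS : S = EpicAlg.ultraproducts (EpicAlg.relSubdirectlyIrreducible Q)) :
    (∀ t : L.Term (Fin 3), EpicAlg.IsMajorityTerm Q t →
      [ EpicAlg.HasSurjectiveEpimorphisms Q,
        EpicAlg.NoProperEpic Q Q,
        EpicAlg.NoProperEpic (EpicAlg.substructures (EpicAlg.binaryProducts S))
          (EpicAlg.binaryProducts S),
        EpicAlg.HasSurjectiveEpimorphisms
          (EpicAlg.substructures (EpicAlg.binaryProducts S)) ].TFAE) ∧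
    (∀ (n : ℕ) (t : L.Term (Fin n)), EpicAlg.IsNearUnanimityTerm Q t →
      ∀ k : ℕ, n ≤ k + 1 →
      [ EpicAlg.HasSurjectiveEpimorphisms Q,
        EpicAlg.NoProperEpic Q Q,
        EpicAlg.NoProperEpic (EpicAlg.substructures (EpicAlg.finiteProducts k S))
          (EpicAlg.finiteProducts k S),
        EpicAlg.HasSurjectiveEpimorphisms
          (EpicAlg.substructures (EpicAlg.finiteProducts k S)) ].TFAE) := by
  subst hS
  have main (n : ℕ) (t : L.Term (Fin n)) (ht : EpicAlg.IsNearUnanimityTerm Q t) (k : ℕ)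
      (hnk : n ≤ k + 1) := by
    have h₁ := hQ.hasSurjectiveEpimorphisms_iff
    have h₂ := hQ.noProperEpic_iff_finiteProducts ht hnk
    have h₃ := EpicAlg.hasSurjectiveEpimorphisms_substructures_iff
      (K := EpicAlg.finiteProducts k (EpicAlg.ultraproducts (EpicAlg.relSubdirectlyIrreducible Q)))
    exact (List.tfae_cons_cons.2 ⟨h₁, List.tfae_cons_cons.2 ⟨h₂, List.tfae_cons_cons.2
      ⟨h₃.symm, List.tfae_singleton _⟩⟩⟩)
  refine ⟨fun t ht => ?_, main⟩
  rw [EpicAlg.binaryProducts_eq_finiteProducts]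
  exact main 3 t ht 2 le_rfl
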